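/- Here $\log$ is the logarithm to base $2$. For $f:\{0,1\}^n\to\{0,1\}$ let $\mathrm{D}_{\mathrm{ave}}(f)=\min_T \mathbb{E}_{x\in\{0,1\}^n}[\mathrm{cost}(T,x)]$, where $x$ is uniformly distributed, $T$ ranges over the deterministic decision trees that compute $f$ on every input, and $\mathrm{cost}(T,x)$ is the number of variables $T$ queries on input $x$. A DNF formula is an OR of terms, a term being an AND of variables or negated variables; its size is the number of its terms and its width is the maximum number of variables in a term. Theorem. There are absolute constants $0<c\le C$ such that for all integers $n\ge 1$ and $w\ge 1$ with $2\log n\le w\le n$ there exists a boolean function $f:\{0,1\}^n\to\{0,1\}$ that is computed by a DNF formula of width $w$ and size $\lceil 2^w/w\rceil$ and satisfies \[ \mathrm{D}_{\mathrm{ave}}(f)=n\left(1-\frac{\log n}{\theta}\right)\quad\text{for some real } \theta \text{ with } c\,w\le\theta\le C\,w, \] that is, $\mathrm{D}_{\mathrm{ave}}(f)=n\left(1-\frac{\log n}{\Theta(w)}\right)$. -/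

import Mathlib

/-- A deterministic decision tree over the boolean variables `x_i`, `i : Fin n`: a leaf carries the
output, an internal node carries the index of the queried variable and the subtrees followed when
the answer is `0` (`false`) and when it is `1` (`true`). -/
inductive DecisionTree (n : ℕ) : Type where
  | leaf : Bool → DecisionTree n
  | node : Fin n → DecisionTree n → DecisionTree n → DecisionTree n

namespace DecisionTree

/-- The value `T(x)`: the label of the leaf reached on input `x`. -/
def eval {n : ℕ} : DecisionTree n → (Fin n → Bool) → Bool
  | leaf b, _ => b
  | node i T₀ T₁, x => if x i then T₁.eval x else T₀.eval x

/-- `cost(T, x)`: the length of the root-to-leaf path followed on input `x`. -/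
def cost {n : ℕ} : DecisionTree n → (Fin n → Bool) → ℕ
  | leaf _, _ => 0
  | node i T₀ T₁, x => (if x i then T₁.cost x else T₀.cost x) + 1

/-- `T` computes `f` with zero error. -/
def Computes {n : ℕ} (T : DecisionTree n) (f : (Fin n → Bool) → Bool) : Prop :=
  ∀ x, T.eval x = f x

/-- The expectation of `cost(T, x)` over a uniformly random input `x`. -/
noncomputable def averageCost {n : ℕ} (T : DecisionTree n) : ℝ :=
  (∑ x : Fin n → Bool, (T.cost x : ℝ)) / 2 ^ n

end DecisionTree

/-- The average-case deterministic query complexity of `f` under the uniform distribution: the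
least average cost of a decision tree that computes `f`. The least value is attained, see
`isLeast_dAve`. -/
noncomputable def dAve {n : ℕ} (f : (Fin n → Bool) → Bool) : ℝ :=
  sInf {r : ℝ | ∃ T : DecisionTree n, T.Computes f ∧ T.averageCost = r}

/-- Every boolean function is computed by some decision tree. -/
theorem DecisionTree.exists_computes {n : ℕ} (f : (Fin n → Bool) → Bool) :
    ∃ T : DecisionTree n, T.Computes f := by
  have key : ∀ (S : Finset (Fin n)) (g : (Fin n → Bool) → Bool),
      (∀ x y : Fin n → Bool, (∀ i ∈ S, x i = y i) → g x = g y) →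
        ∃ T : DecisionTree n, T.Computes g := by
    intro S
    induction S using Finset.induction_on with
    | empty =>
      intro g hg
      exact ⟨.leaf (g fun _ => false), fun x => hg _ _ (by simp)⟩
    | insert i S _ ih =>
      intro g hg
      have dep : ∀ b : Bool, ∃ T : DecisionTree n,
          T.Computes fun x => g (Function.update x i b) := by
        intro b
        refine ih _ fun x y hxy => hg _ _ fun j hj => ?_
        by_cases hji : j = i
        · subst hji; simp
        · simp only [Function.update_of_ne hji]
          exact hxy j ((Finset.mem_insert.1 hj).resolve_left hji)
      obtain ⟨T₀, h₀⟩ := dep false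
      obtain ⟨T₁, h₁⟩ := dep true
      refine ⟨.node i T₀ T₁, fun x => ?_⟩
      have hx := Function.update_eq_self i x
      cases hb : x i
      · rw [hb] at hx
        simp [DecisionTree.eval, hb, h₀ x, hx]
      · rw [hb] at hx
        simp [DecisionTree.eval, hb, h₁ x, hx]
  exact key Finset.univ f fun x y h => congrArg f (funext fun i => h i (Finset.mem_univ i))

/-- The infimum in the definition of `dAve` is a minimum. -/
theorem isLeast_dAve {n : ℕ} (f : (Fin n → Bool) → Bool) :
    IsLeast {r : ℝ | ∃ T : DecisionTree n, T.Computes f ∧ T.averageCost = r} (dAve f) := by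
  classical
  have hne : ∃ k : ℕ, ∃ T : DecisionTree n, T.Computes f ∧ ∑ x, T.cost x = k := by
    obtain ⟨T, hT⟩ := DecisionTree.exists_computes f
    exact ⟨_, T, hT, rfl⟩
  obtain ⟨T, hT, hk⟩ := Nat.find_spec hne
  have hl : IsLeast {r : ℝ | ∃ T : DecisionTree n, T.Computes f ∧ T.averageCost = r}
      T.averageCost := by
    refine ⟨⟨T, hT, rfl⟩, ?_⟩
    rintro r ⟨T', hT', rfl⟩
    have h := Nat.find_min' hne ⟨T', hT', rfl⟩
    rw [← hk] at h
    unfold DecisionTree.averageCost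
    refine div_le_div_of_nonneg_right ?_ (by positivity)
    exact_mod_cast h
  have he : dAve f = T.averageCost := hl.csInf_eq
  rw [he]
  exact hl

/-- A term: a logical AND of literals. The literal `(i, true)` is the variable `x_i`, the literal
`(i, false)` is its negation. -/
structure DNFTerm (n : ℕ) : Type where
  literals : Finset (Fin n × Bool)

namespace DNFTerm

/-- The value of the term on the input `x`. -/
def eval {n : ℕ} (t : DNFTerm n) (x : Fin n → Bool) : Bool :=
  decide (∀ l ∈ t.literals, x l.1 = l.2)

/-- The number of variables that occur in the term. -/
def width {n : ℕ} (t : DNFTerm n) : ℕ :=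
  (t.literals.image Prod.fst).card

end DNFTerm

/-- A DNF formula: a logical OR of terms. -/
structure DNF (n : ℕ) : Type where
  terms : List (DNFTerm n)

namespace DNF

/-- The value of the formula on the input `x`. -/
def eval {n : ℕ} (φ : DNF n) (x : Fin n → Bool) : Bool :=
  φ.terms.any fun t => t.eval x

/-- The number of terms. -/
def size {n : ℕ} (φ : DNF n) : ℕ :=
  φ.terms.length

/-- The maximum number of variables of a term (`0` if there is no term). -/
def width {n : ℕ} (φ : DNF n) : ℕ :=
  (φ.terms.map DNFTerm.width).foldr max 0

/-- The formula computes `f`. -/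
def Computes {n : ℕ} (φ : DNF n) (f : (Fin n → Bool) → Bool) : Prop :=
  ∀ x, φ.eval x = f x

end DNF

/-! The function is a union of s subcubes of codimension w, with s about 2^w / w. It has to be shown
that the gap n − `dAve f` has order n log n / w.

The gap is not larger for a good choice of terms. A random term takes one literal from each residue
class modulo w, through M = n / w + 1 indices per class. Given a subcube with k free variables, a
class with a free indices offers M + a compatible literals out of 2M. Since 1 + t ≥ 2^t on [0, 1],
the term meets the subcube with probability at least 2^(k/M) / 2^w. If 2^(k/M) ≥ 2nw, then s
independent terms all miss it with probability at most e^(-2n), and only 4^n pairs (Q, x) compete,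
so some choice hits all these subcubes (`exists_hitting_terms`). A zero of f then has no certificate
that leaves k variables free, and the ones of f are rare (`le_dAve_unionOfSubcubes`).

The gap is not smaller for any choice of terms, once n, w ≥ 4. Leave each variable free with
probability α = ln n / (4w), query the others, then query the free variables of the terms not yet
falsified. The first stage saves αn on average; the second costs at most a constant times α n^(1/4)
(`dAve_unionOfSubcubes_le`), which is at most 9/10 of the saving. -/

/-! ### Building trees by stages; certificates -/

namespace DecisionTree

variable {n : ℕ}

/-- Trees for the subcubes obtained by fixing the variables in `Q` are combined to one tree by
first querying all of `Q`. -/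
theorem exists_query_first (f : (Fin n → Bool) → Bool) (B : (Fin n → Bool) → ℕ)
    (Q : Finset (Fin n)) : ∀ C : Set (Fin n → Bool),
      (∀ x ∈ C, ∃ T : DecisionTree n, ∀ y ∈ C, (∀ i ∈ Q, y i = x i) →
        T.eval y = f y ∧ T.cost y ≤ B y) →
      ∃ T : DecisionTree n, ∀ y ∈ C, T.eval y = f y ∧ T.cost y ≤ Q.card + B y := by
  classical
  induction Q using Finset.induction_on with
  | empty =>
    intro C h
    rcases C.eq_empty_or_nonempty with rfl | ⟨x, hx⟩
    · exact ⟨.leaf true, by simp⟩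
    · obtain ⟨T, hT⟩ := h x hx
      exact ⟨T, fun y hy => by simpa using hT y hy (by simp)⟩
  | insert i Q hi ih =>
    intro C h
    -- The induction runs over all domains C, so each answer to the query of `i` may restrict C.
    have branch : ∀ b : Bool, ∃ T : DecisionTree n, ∀ y ∈ {y ∈ C | y i = b},
        T.eval y = f y ∧ T.cost y ≤ Q.card + B y := by
      intro b
      refine ih _ fun x hx => ?_
      obtain ⟨T, hT⟩ := h x hx.1
      refine ⟨T, fun y hy hyx => hT y hy.1 fun j hj => ?_⟩
      rcases Finset.mem_insert.1 hj with rfl | hj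
      · rw [hy.2, hx.2]
      · exact hyx j hj
    obtain ⟨T₀, h₀⟩ := branch false
    obtain ⟨T₁, h₁⟩ := branch true
    refine ⟨.node i T₀ T₁, fun y hy => ?_⟩
    rw [Finset.card_insert_of_notMem hi]
    cases hb : y i
    · have := h₀ y ⟨hy, hb⟩
      simp only [eval, cost, hb, Bool.false_eq_true, if_false]
      exact ⟨this.1, by omega⟩
    · have := h₁ y ⟨hy, hb⟩
      simp only [eval, cost, hb, if_true]
      exact ⟨this.1, by omega⟩

/-- A two-stage tree: query `Q`, then the set `V x` of relevant variables that remain. -/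
theorem exists_two_stage (f : (Fin n → Bool) → Bool) (Q : Finset (Fin n))
    (V : (Fin n → Bool) → Finset (Fin n))
    (hV : ∀ x y : Fin n → Bool, (∀ i ∈ Q, y i = x i) → V y = V x)
    (hf : ∀ x y : Fin n → Bool, (∀ i ∈ Q, y i = x i) → (∀ i ∈ V x, y i = x i) → f y = f x) :
    ∃ T : DecisionTree n, T.Computes f ∧ ∀ x, T.cost x ≤ Q.card + (V x).card := by
  obtain ⟨T, hT⟩ := exists_query_first f (fun x => (V x).card) Q Set.univ fun x _ => by
    -- Second stage: among the inputs that agree with `x` on `Q`, the values on `V x` determine f,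
    -- so leaves suffice.
    obtain ⟨T, hT⟩ := exists_query_first f (fun _ => 0) (V x) {y | ∀ i ∈ Q, y i = x i}
      fun z hz => ⟨.leaf (f z), fun y hy hyz => ⟨(hf z y (fun i hi => (hy i hi).trans
        (hz i hi).symm) (by rw [hV x z hz]; exact hyz)).symm, le_rfl⟩⟩
    exact ⟨T, fun y _ hy => ⟨(hT y hy).1, by simpa [hV x y hy] using (hT y hy).2⟩⟩
  exact ⟨T, fun x => (hT x trivial).1, fun x => (hT x trivial).2⟩

/-- The variables queried on `x` certify the output on `x`. -/
theorem exists_certificate (T : DecisionTree n) (x : Fin n → Bool) :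
    ∃ Q : Finset (Fin n), Q.card ≤ T.cost x ∧
      ∀ y : Fin n → Bool, (∀ i ∈ Q, y i = x i) → T.eval y = T.eval x := by
  classical
  induction T with
  | leaf b => exact ⟨∅, by simp, fun _ _ => rfl⟩
  | node i T₀ T₁ ih₀ ih₁ =>
    -- Adding `i` to the certificate of the subtree forces `y` into the same branch as `x`.
    have key : ∀ T : DecisionTree n, (∃ Q : Finset (Fin n), Q.card ≤ T.cost x ∧
        ∀ y : Fin n → Bool, (∀ i ∈ Q, y i = x i) → T.eval y = T.eval x) →
        ∃ Q : Finset (Fin n), Q.card ≤ T.cost x + 1 ∧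
          ∀ y : Fin n → Bool, (∀ i ∈ Q, y i = x i) → y i = x i ∧ T.eval y = T.eval x := by
      rintro T ⟨Q, hQ, h⟩
      exact ⟨insert i Q, (Finset.card_insert_le _ _).trans (by omega), fun y hy =>
        ⟨hy i (by simp), h y fun j hj => hy j (by simp [hj])⟩⟩
    cases hb : x i
    · obtain ⟨Q, hQ, h⟩ := key T₀ ih₀
      refine ⟨Q, by simpa [cost, hb] using hQ, fun y hy => ?_⟩
      obtain ⟨h1, h2⟩ := h y hy
      rw [hb] at h1
      simp [eval, hb, h1, h2]
    · obtain ⟨Q, hQ, h⟩ := key T₁ ih₁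
      refine ⟨Q, by simpa [cost, hb] using hQ, fun y hy => ?_⟩
      obtain ⟨h1, h2⟩ := h y hy
      rw [hb] at h1
      simp [eval, hb, h1, h2]

end DecisionTree

theorem dAve_le_averageCost {n : ℕ} {f : (Fin n → Bool) → Bool} {T : DecisionTree n}
    (hT : T.Computes f) : dAve f ≤ T.averageCost :=
  (isLeast_dAve f).2 ⟨T, hT, rfl⟩

theorem exists_averageCost_eq_dAve {n : ℕ} (f : (Fin n → Bool) → Bool) :
    ∃ T : DecisionTree n, T.Computes f ∧ T.averageCost = dAve f :=
  (isLeast_dAve f).1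

theorem dAve_nonneg {n : ℕ} (f : (Fin n → Bool) → Bool) : 0 ≤ dAve f := by
  obtain ⟨T, -, h⟩ := exists_averageCost_eq_dAve f
  rw [← h, DecisionTree.averageCost]
  positivity

/-! ### DNF formulas as unions of subcubes -/

/-- The term that is true exactly on the inputs that agree with `σ` on `A`. -/
def DNFTerm.ofSubcube {n : ℕ} (A : Finset (Fin n)) (σ : Fin n → Bool) : DNFTerm n :=
  ⟨A.image fun i => (i, σ i)⟩

theorem DNFTerm.width_ofSubcube {n : ℕ} (A : Finset (Fin n)) (σ : Fin n → Bool) :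
    (DNFTerm.ofSubcube A σ).width = A.card := by
  simp [width, ofSubcube, Finset.image_image, Function.comp_def]

theorem DNFTerm.eval_ofSubcube {n : ℕ} (A : Finset (Fin n)) (σ x : Fin n → Bool) :
    (DNFTerm.ofSubcube A σ).eval x = decide (∀ i ∈ A, x i = σ i) := by
  simp [eval, ofSubcube]

/-- The indicator function of a union of `s` subcubes. -/
def unionOfSubcubes {n s : ℕ} (A : Fin s → Finset (Fin n)) (σ : Fin s → Fin n → Bool)
    (x : Fin n → Bool) : Bool :=
  decide (∃ t, ∀ i ∈ A t, x i = σ t i)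

theorem DNF.width_eq_of_forall {n w : ℕ} (l : List (DNFTerm n)) (hne : l ≠ [])
    (h : ∀ t ∈ l, t.width = w) : (DNF.mk l).width = w := by
  induction l with
  | nil => exact absurd rfl hne
  | cons t l ih =>
    rcases eq_or_ne l [] with rfl | hl
    · simpa [DNF.width] using h t (by simp)
    · have := ih hl fun u hu => h u (by simp [hu])
      simp only [DNF.width, List.map_cons, List.foldr_cons] at this ⊢
      rw [this, h t (by simp), max_self]

theorem exists_dnf_unionOfSubcubes {n s w : ℕ} (hs : 0 < s) (A : Fin s → Finset (Fin n))
    (σ : Fin s → Fin n → Bool) (hA : ∀ t, (A t).card = w) :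
    ∃ φ : DNF n, φ.Computes (unionOfSubcubes A σ) ∧ φ.width = w ∧ φ.size = s := by
  refine ⟨⟨List.ofFn fun t => DNFTerm.ofSubcube (A t) (σ t)⟩, fun x => ?_, ?_, ?_⟩
  · rw [Bool.eq_iff_iff]
    simp [DNF.eval, unionOfSubcubes, DNFTerm.eval_ofSubcube, List.mem_ofFn]
  · refine DNF.width_eq_of_forall _ ?_ ?_
    · rw [Ne, List.ofFn_eq_nil_iff]; omega
    · intro u hu
      obtain ⟨t, rfl⟩ := List.mem_ofFn.1 hu
      rw [DNFTerm.width_ofSubcube, hA]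
  · simp [DNF.size]

/-! ### Lower bound on the average cost when every large subcube is hit -/

theorem card_filter_eqOn {n : ℕ} (A : Finset (Fin n)) (σ : Fin n → Bool) :
    ((Finset.univ.filter fun x : Fin n → Bool => ∀ i ∈ A, x i = σ i).card : ℝ) * 2 ^ A.card
      = 2 ^ n := by
  have h : (Finset.univ.filter fun x : Fin n → Bool => ∀ i ∈ A, x i = σ i)
      = Fintype.piFinset fun i => if i ∈ A then {σ i} else Finset.univ := by
    ext x
    simp only [Finset.mem_filter, Finset.mem_univ, true_and, Fintype.mem_piFinset]
    refine forall_congr' fun i => ?_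
    by_cases hi : i ∈ A <;> simp [hi]
  have h2 : ∀ i, (if i ∈ A then ({σ i} : Finset Bool) else Finset.univ).card
      = if i ∈ A then 1 else 2 := fun i => by split_ifs <;> simp
  rw [h, Fintype.card_piFinset]
  simp only [h2]
  push_cast
  rw [← Finset.prod_const, ← Finset.prod_ite_mem_eq A, ← Finset.prod_mul_distrib]
  · rw [Finset.prod_congr rfl (g := fun _ => (2 : ℝ)) fun i _ => by by_cases hi : i ∈ A <;> simp [hi]]
    simp

/-- If every subcube with `k` free variables meets one of the subcubes, then most inputs need
more than `n - k` queries. -/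
theorem le_dAve_unionOfSubcubes {n s w k : ℕ} (A : Fin s → Finset (Fin n))
    (σ : Fin s → Fin n → Bool) (hA : ∀ t, (A t).card = w)
    (hk : ∀ (Q : Finset (Fin n)) (x : Fin n → Bool), k ≤ Qᶜ.card →
      ∃ t, ∀ i ∈ A t, i ∈ Q → x i = σ t i) :
    (n : ℝ) - k - n * (s / 2 ^ w) ≤ dAve (unionOfSubcubes A σ) := by
  classical
  obtain ⟨T, hT, hD⟩ := exists_averageCost_eq_dAve (unionOfSubcubes A σ)
  -- If x satisfies a term, the sum is at least 1 and the left side is at most 0. Only the zeros of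
  -- f need the certificate argument.
  have hcost : ∀ x, (n : ℝ) - k - n * ∑ t, (if ∀ i ∈ A t, x i = σ t i then (1 : ℝ) else 0)
      ≤ T.cost x := by
    intro x
    have hnn : ∀ t ∈ Finset.univ, 0 ≤ (if ∀ i ∈ A t, x i = σ t i then (1 : ℝ) else 0) :=
      fun t _ => by split_ifs <;> norm_num
    by_cases hx : ∃ t, ∀ i ∈ A t, x i = σ t i
    · obtain ⟨t, ht⟩ := hx
      have h1 := Finset.single_le_sum hnn (Finset.mem_univ t)
      rw [if_pos ht] at h1
      have h2 : (0 : ℝ) ≤ T.cost x := by positivity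
      have h3 : (0 : ℝ) ≤ n := by positivity
      have h4 : (0 : ℝ) ≤ k := by positivity
      nlinarith
    · obtain ⟨Q, hQ, hc⟩ := T.exists_certificate x
      have hlt : Qᶜ.card < k := by
        by_contra! hge
        obtain ⟨t, ht⟩ := hk Q x hge
        -- This input agrees with `x` on the certificate and yet satisfies term `t`.
        have h1 := hc (fun i => if i ∈ Q then x i else σ t i) fun i hi => by simp [hi]
        rw [hT, hT] at h1
        have h2 : unionOfSubcubes A σ x = false := by simpa [unionOfSubcubes] using hx
        rw [h2] at h1
        simp only [unionOfSubcubes, decide_eq_false_iff_not] at h1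
        refine h1 ⟨t, fun i hi => ?_⟩
        by_cases hiQ : i ∈ Q
        · simpa [hiQ] using ht i hi hiQ
        · simp [hiQ]
      have h3 : n < k + T.cost x := by
        have := Finset.card_add_card_compl Q
        rw [Fintype.card_fin] at this
        omega
      have h4 : (n : ℝ) < k + T.cost x := by exact_mod_cast h3
      have h5 := Finset.sum_nonneg hnn
      have h6 : (0 : ℝ) ≤ n := by positivity
      nlinarith [mul_nonneg h6 h5]
  have hsum := Finset.sum_le_sum fun x (_ : x ∈ Finset.univ) => hcost x
  have hswap : ∑ x : Fin n → Bool, ∑ t, (if ∀ i ∈ A t, x i = σ t i then (1 : ℝ) else 0)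
      = s / 2 ^ w * 2 ^ n := by
    rw [Finset.sum_comm]
    have : ∀ t, ∑ x : Fin n → Bool, (if ∀ i ∈ A t, x i = σ t i then (1 : ℝ) else 0)
        = 2 ^ n / 2 ^ w := by
      intro t
      rw [Finset.sum_boole, eq_div_iff (by positivity), ← hA t]
      exact card_filter_eqOn (A t) (σ t)
    rw [Finset.sum_congr rfl fun t _ => this t]
    simp
    ring
  rw [Finset.sum_sub_distrib, ← Finset.mul_sum, hswap] at hsum
  rw [← hD, DecisionTree.averageCost, le_div_iff₀ (by positivity)]
  simp at hsum
  linarith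

/-! ### Upper bound by a random restriction -/

/-- Independence of the coordinates: it reduces the survival probability of a term to a computation
for each variable. -/
theorem sum_sum_prod_eq_prod_sum_sum {ι α β : Type*} [Fintype ι] [DecidableEq ι] [Fintype α]
    [Fintype β] (h : ι → α → β → ℝ) :
    ∑ q : ι → α, ∑ x : ι → β, ∏ i, h i (q i) (x i) = ∏ i, ∑ a, ∑ b, h i a b := by
  rw [Finset.prod_univ_sum, Fintype.piFinset_univ]
  refine Finset.sum_congr rfl fun q _ => ?_
  rw [Finset.prod_univ_sum, Fintype.piFinset_univ]

/-- The probability that a variable is queried (`true`) or left free (`false`). -/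
def queryWeight (α : ℝ) (b : Bool) : ℝ := if b then 1 - α else α

/-- The expected number of queries that a two-stage tree with query set `Q` makes. -/
theorem dAve_unionOfSubcubes_le_of_query {n s : ℕ} (A : Fin s → Finset (Fin n))
    (σ : Fin s → Fin n → Bool) (q : Fin n → Bool) :
    dAve (unionOfSubcubes A σ) * 2 ^ n ≤ ∑ x : Fin n → Bool,
      ((∑ i, if q i then (1 : ℝ) else 0) + ∑ t, ∑ i ∈ A t,
        if q i = false ∧ ∀ j ∈ A t, q j = true → x j = σ t j then (1 : ℝ) else 0) := by
  classical
  -- `S x` consists of the terms not falsified by the answers on `Q`, and `V x` of their free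
  -- variables. All other terms are already false.
  set S : (Fin n → Bool) → Finset (Fin s) := fun x =>
    Finset.univ.filter fun t => ∀ j ∈ A t, q j = true → x j = σ t j with hS
  set V : (Fin n → Bool) → Finset (Fin n) := fun x =>
    (S x).biUnion fun t => (A t).filter fun i => q i = false with hV
  set Q : Finset (Fin n) := Finset.univ.filter fun i => q i = true with hQ
  have hSeq : ∀ x y : Fin n → Bool, (∀ i ∈ Q, y i = x i) → S y = S x := by
    intro x y h
    refine Finset.filter_congr fun t _ => ?_
    refine forall_congr' fun j => forall_congr' fun _ => forall_congr' fun hj => ?_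
    rw [h j (by simp [hQ, hj])]
  obtain ⟨T, hT, hcost⟩ := DecisionTree.exists_two_stage (unionOfSubcubes A σ) Q V
    (fun x y h => by simp only [hV, hSeq x y h]) (fun x y h h' => by
      unfold unionOfSubcubes
      refine decide_eq_decide.2 (exists_congr fun t => ?_)
      have agree : t ∈ S x → ∀ i ∈ A t, y i = x i := fun ht i hi => by
        cases hqi : q i
        · exact h' i (Finset.mem_biUnion.2 ⟨t, ht, by simp [hi, hqi]⟩)
        · exact h i (by simp [hQ, hqi])
      constructor
      · intro hy i hi
        have ht : t ∈ S y := by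
          simp only [hS, Finset.mem_filter, Finset.mem_univ, true_and]
          exact fun j hj _ => hy j hj
        rw [← agree (hSeq x y h ▸ ht) i hi, hy i hi]
      · intro hx i hi
        have ht : t ∈ S x := by
          simp only [hS, Finset.mem_filter, Finset.mem_univ, true_and]
          exact fun j hj _ => hx j hj
        rw [agree ht i hi, hx i hi])
  have h1 := dAve_le_averageCost hT
  rw [DecisionTree.averageCost, le_div_iff₀ (by positivity)] at h1
  refine h1.trans (Finset.sum_le_sum fun x _ => ?_)
  have h2 : (T.cost x : ℝ) ≤ Q.card + (V x).card := by exact_mod_cast hcost x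
  refine h2.trans (add_le_add ?_ ?_)
  · rw [Finset.sum_boole]
  -- Free variables shared by several surviving terms are counted once for each of them.
  · have h3 : (V x).card ≤ ∑ t ∈ S x, ((A t).filter fun i => q i = false).card :=
      Finset.card_biUnion_le
    refine (Nat.cast_le.2 h3).trans ?_
    rw [hS, Finset.sum_filter]
    push_cast
    refine Finset.sum_le_sum fun t _ => ?_
    split_ifs with h
    · rw [← Finset.sum_boole]
      refine le_of_eq (Finset.sum_congr rfl fun i _ => ?_)
      by_cases hi : q i = false
      · rw [if_pos hi, if_pos ⟨hi, h⟩]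
      · rw [if_neg hi, if_neg fun h' => hi h'.1]
    · exact_mod_cast Finset.sum_nonneg fun i _ => by split_ifs <;> norm_num

theorem sum_prod_queryWeight (α : ℝ) (n : ℕ) :
    ∑ q : Fin n → Bool, ∏ i, queryWeight α (q i) = 1 := by
  have := Finset.prod_univ_sum (fun _ : Fin n => (Finset.univ : Finset Bool))
    (fun _ b => queryWeight α b)
  rw [Fintype.piFinset_univ] at this
  rw [← this]
  simp [queryWeight]

theorem sum_prod_queryWeight_mul_indicator (α : ℝ) {n : ℕ} (i : Fin n) :
    ∑ q : Fin n → Bool, (∏ j, queryWeight α (q j)) * (if q i then 1 else 0) = 1 - α := by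
  have := Finset.prod_univ_sum (fun _ : Fin n => (Finset.univ : Finset Bool))
    (fun j b => queryWeight α b * (if j = i then (if b then 1 else 0) else 1))
  rw [Fintype.piFinset_univ] at this
  simp only [Finset.prod_mul_distrib, Finset.prod_ite_eq', Finset.mem_univ, if_true] at this
  rw [← this, Finset.prod_eq_single i]
  · simp [queryWeight]
  · intro j _ hj
    simp [queryWeight, hj]
  · simp

/-- The probability that a term survives a random restriction that leaves its variable `i`
free. -/
theorem sum_prod_queryWeight_mul_survives (α : ℝ) {n : ℕ} (A : Finset (Fin n))
    (σ : Fin n → Bool) {i : Fin n} (hi : i ∈ A) :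
    ∑ q : Fin n → Bool, (∏ j, queryWeight α (q j)) * ∑ x : Fin n → Bool,
      (if q i = false ∧ ∀ j ∈ A, q j = true → x j = σ j then (1 : ℝ) else 0)
      = α * ((1 + α) / 2) ^ (A.card - 1) * 2 ^ n := by
  classical
  set h : Fin n → Bool → Bool → ℝ := fun j a b => queryWeight α a *
    ((if j = i then (if a = false then 1 else 0) else 1) *
      (if j ∈ A → a = true → b = σ j then 1 else 0)) with hh
  have h1 : ∀ q x : Fin n → Bool, (∏ j, queryWeight α (q j)) *
      (if q i = false ∧ ∀ j ∈ A, q j = true → x j = σ j then (1 : ℝ) else 0)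
      = ∏ j, h j (q j) (x j) := by
    intro q x
    simp only [hh, Finset.prod_mul_distrib, Finset.prod_ite_eq', Finset.mem_univ, if_true]
    rw [Finset.prod_boole]
    by_cases h1 : q i = false <;> by_cases h2 : ∀ j ∈ A, q j = true → x j = σ j <;>
      simp [h1, h2]
  simp only [Finset.mul_sum, h1]
  rw [sum_sum_prod_eq_prod_sum_sum]
  have hi' : ∑ a, ∑ b, h i a b = α * 2 := by
    simp [hh, queryWeight]; ring
  -- A free variable allows both values of x (weight 2α), a queried one only the value in σ (weight
  -- 1 − α). The factor 2 is kept apart to build 2^n.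
  have hA : ∀ j ∈ A.erase i, ∑ a, ∑ b, h j a b = (1 + α) / 2 * 2 := by
    intro j hj
    obtain ⟨hji, hjA⟩ := Finset.mem_erase.1 hj
    cases hσ : σ j <;> simp [hh, queryWeight, hji, hjA, hσ]
  have hN : ∀ j ∈ Aᶜ, ∑ a, ∑ b, h j a b = 2 := by
    intro j hj
    have hjA := Finset.mem_compl.1 hj
    have hji : j ≠ i := fun h => hjA (h ▸ hi)
    simp [hh, queryWeight, hji, hjA]
  rw [← Finset.prod_mul_prod_compl A, ← Finset.mul_prod_erase A _ hi, hi',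
    Finset.prod_congr rfl hA, Finset.prod_congr rfl hN, Finset.prod_const, Finset.prod_const,
    Finset.card_erase_of_mem hi, mul_pow]
  have hc : n = 1 + (A.card - 1) + Aᶜ.card := by
    have h1 := Finset.card_add_card_compl A
    have h2 := Finset.card_pos.2 ⟨i, hi⟩
    rw [Fintype.card_fin] at h1
    omega
  have h2 : (2 : ℝ) ^ n = 2 * 2 ^ (A.card - 1) * 2 ^ Aᶜ.card := by
    conv_lhs => rw [hc, pow_add, pow_add, pow_one]
  rw [h2]
  ring

/-- The upper bound from a random restriction that leaves each variable free with
probability `α`. -/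
theorem dAve_unionOfSubcubes_le {n s w : ℕ} (A : Fin s → Finset (Fin n))
    (σ : Fin s → Fin n → Bool) (hA : ∀ t, (A t).card = w) {α : ℝ} (h0 : 0 ≤ α) (h1 : α ≤ 1) :
    dAve (unionOfSubcubes A σ) ≤ n - n * α + s * (w * (α * ((1 + α) / 2) ^ (w - 1))) := by
  have hw : ∀ q : Fin n → Bool, 0 ≤ ∏ i, queryWeight α (q i) := fun q =>
    Finset.prod_nonneg fun i _ => by unfold queryWeight; split_ifs <;> linarith
  -- The bound holds for every `q`, hence for the weighted average over `q`, as the weights are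
  -- nonnegative with sum 1.
  have hsum := Finset.sum_le_sum fun q (_ : q ∈ Finset.univ) =>
    mul_le_mul_of_nonneg_left (dAve_unionOfSubcubes_le_of_query A σ q) (hw q)
  rw [← Finset.sum_mul, sum_prod_queryWeight, one_mul] at hsum
  have hQ : ∑ q : Fin n → Bool, (∏ j, queryWeight α (q j)) *
      ∑ x : Fin n → Bool, (∑ i, if q i then (1 : ℝ) else 0) = n * (1 - α) * 2 ^ n := by
    simp only [Finset.sum_const, Finset.card_univ, Fintype.card_pi_const, Fintype.card_bool,
      nsmul_eq_mul]
    have : ∀ q : Fin n → Bool, (∏ j, queryWeight α (q j)) *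
        (((2 ^ n : ℕ) : ℝ) * ∑ i, if q i then (1 : ℝ) else 0)
        = ∑ i, 2 ^ n * ((∏ j, queryWeight α (q j)) * if q i then (1 : ℝ) else 0) := by
      intro q
      rw [← Finset.mul_sum, ← Finset.mul_sum]
      push_cast
      ring
    rw [Finset.sum_congr rfl fun q _ => this q, Finset.sum_comm]
    simp only [← Finset.mul_sum, sum_prod_queryWeight_mul_indicator]
    simp
    ring
  have hV : ∑ q : Fin n → Bool, (∏ j, queryWeight α (q j)) *
      ∑ x : Fin n → Bool, (∑ t, ∑ i ∈ A t,
        if q i = false ∧ ∀ j ∈ A t, q j = true → x j = σ t j then (1 : ℝ) else 0)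
      = s * (w * (α * ((1 + α) / 2) ^ (w - 1))) * 2 ^ n := by
    have : ∀ q : Fin n → Bool, (∏ j, queryWeight α (q j)) *
        ∑ x : Fin n → Bool, (∑ t, ∑ i ∈ A t,
          if q i = false ∧ ∀ j ∈ A t, q j = true → x j = σ t j then (1 : ℝ) else 0)
        = ∑ t, ∑ i ∈ A t, (∏ j, queryWeight α (q j)) * ∑ x : Fin n → Bool,
          if q i = false ∧ ∀ j ∈ A t, q j = true → x j = σ t j then (1 : ℝ) else 0 := by
      intro q
      rw [Finset.sum_comm, Finset.mul_sum]
      refine Finset.sum_congr rfl fun t _ => ?_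
      rw [Finset.sum_comm, Finset.mul_sum]
    rw [Finset.sum_congr rfl fun q _ => this q, Finset.sum_comm]
    have ht : ∀ t, ∑ q : Fin n → Bool, ∑ i ∈ A t, (∏ j, queryWeight α (q j)) *
        ∑ x : Fin n → Bool,
          (if q i = false ∧ ∀ j ∈ A t, q j = true → x j = σ t j then (1 : ℝ) else 0)
        = w * (α * ((1 + α) / 2) ^ (w - 1)) * 2 ^ n := by
      intro t
      rw [Finset.sum_comm, Finset.sum_congr rfl fun i hi =>
        sum_prod_queryWeight_mul_survives α (A t) (σ t) hi, Finset.sum_const, hA, nsmul_eq_mul]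
      ring
    rw [Finset.sum_congr rfl fun t _ => ht t]
    simp
    ring
  simp only [Finset.sum_add_distrib, mul_add] at hsum
  rw [hQ, hV, ← add_mul] at hsum
  have := le_of_mul_le_mul_right hsum (by positivity)
  linarith

/-! ### Random terms with one literal per residue class -/

/-- The variables congruent to `r` modulo `w`, enumerated (with repetitions) by `Fin (n / w + 1)`. -/
def residueVar {n w : ℕ} (hwn : w ≤ n) (r : Fin w) (q : Fin (n / w + 1)) : Fin n :=
  -- Only the last index can overflow; it then repeats the least element, so that all classes have
  -- equally many indices.
  if h : q.1 * w + r.1 < n then ⟨q.1 * w + r.1, h⟩ else ⟨r.1, r.2.trans_le hwn⟩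

theorem residueVar_mod {n w : ℕ} (hwn : w ≤ n) (r : Fin w) (q : Fin (n / w + 1)) :
    (residueVar hwn r q).1 % w = r.1 := by
  unfold residueVar
  split_ifs
  · simp [Nat.mod_eq_of_lt r.2, Nat.add_mod]
  · simp [Nat.mod_eq_of_lt r.2]

theorem exists_residueVar_eq {n w : ℕ} (hw : 0 < w) (hwn : w ≤ n) (j : Fin n) :
    ∃ r q, residueVar hwn r q = j := by
  refine ⟨⟨j.1 % w, Nat.mod_lt _ hw⟩,
    ⟨j.1 / w, Nat.lt_succ_of_le (Nat.div_le_div_right j.2.le)⟩, ?_⟩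
  have h : j.1 / w * w + j.1 % w = j.1 := Nat.div_add_mod' _ _
  unfold residueVar
  simp [h]

/-- A code for a term with one literal from each residue class modulo `w`. -/
abbrev TermCode (n w : ℕ) : Type := Fin w → Fin (n / w + 1) × Bool

def TermCode.vars {n w : ℕ} (hwn : w ≤ n) (g : TermCode n w) : Finset (Fin n) :=
  Finset.univ.image fun r => residueVar hwn r (g r).1

def TermCode.signs {n w : ℕ} (hw : 0 < w) (g : TermCode n w) (j : Fin n) : Bool :=
  (g ⟨j.1 % w, Nat.mod_lt _ hw⟩).2

/-- Variables from different classes are distinct; drawing one from each class makes the width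
exactly w. -/
theorem TermCode.card_vars {n w : ℕ} (hwn : w ≤ n) (g : TermCode n w) :
    (g.vars hwn).card = w := by
  unfold vars
  rw [Finset.card_image_of_injective, Finset.card_univ, Fintype.card_fin]
  intro r r' h
  have := congrArg (fun j : Fin n => j.1 % w) h
  simp only [residueVar_mod] at this
  exact Fin.ext this

theorem TermCode.signs_residueVar {n w : ℕ} (hw : 0 < w) (hwn : w ≤ n) (g : TermCode n w)
    (r : Fin w) (q : Fin (n / w + 1)) : g.signs hw (residueVar hwn r q) = (g r).2 := by
  unfold signs
  congr 2
  exact Fin.ext (residueVar_mod hwn r q)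

/-- The terms that meet the subcube of inputs that agree with `x` on `Q`. -/
def compatibleCodes {n w : ℕ} (hwn : w ≤ n) (Q : Finset (Fin n)) (x : Fin n → Bool) :
    Finset (TermCode n w) :=
  Fintype.piFinset fun r => Finset.univ.filter fun p : Fin (n / w + 1) × Bool =>
    residueVar hwn r p.1 ∈ Q → x (residueVar hwn r p.1) = p.2

theorem agree_of_mem_compatibleCodes {n w : ℕ} (hw : 0 < w) (hwn : w ≤ n) {Q : Finset (Fin n)}
    {x : Fin n → Bool} {g : TermCode n w} (hg : g ∈ compatibleCodes hwn Q x) :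
    ∀ i ∈ g.vars hwn, i ∈ Q → x i = g.signs hw i := by
  intro i hi hiQ
  obtain ⟨r, -, rfl⟩ := Finset.mem_image.1 hi
  rw [TermCode.signs_residueVar]
  have := Fintype.mem_piFinset.1 hg r
  simp only [Finset.mem_filter, Finset.mem_univ, true_and] at this
  exact this hiQ

/-- An index whose variable lies in `Q` admits one sign, any other index admits both. -/
theorem card_compatible_literals {n w : ℕ} (hwn : w ≤ n) (Q : Finset (Fin n))
    (x : Fin n → Bool) (r : Fin w) :
    (Finset.univ.filter fun p : Fin (n / w + 1) × Bool =>
      residueVar hwn r p.1 ∈ Q → x (residueVar hwn r p.1) = p.2).card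
      = (n / w + 1) + (Finset.univ.filter fun q => residueVar hwn r q ∉ Q).card := by
  rw [Finset.card_filter, Fintype.sum_prod_type, Finset.card_filter]
  have : ∀ q : Fin (n / w + 1), (∑ b : Bool, if residueVar hwn r q ∈ Q →
      x (residueVar hwn r q) = b then 1 else 0)
      = 1 + if residueVar hwn r q ∉ Q then 1 else 0 := by
    intro q
    by_cases h : residueVar hwn r q ∈ Q
    · cases hx : x (residueVar hwn r q) <;> simp [h]
    · simp [h]
  simp only [this, Finset.sum_add_distrib]
  simp

/-- Every free variable has an index; repeated indices only enlarge the right side. -/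
theorem card_compl_le_sum {n w : ℕ} (hw : 0 < w) (hwn : w ≤ n) (Q : Finset (Fin n)) :
    Qᶜ.card ≤ ∑ r : Fin w, (Finset.univ.filter fun q => residueVar hwn r q ∉ Q).card := by
  classical
  rw [← Finset.card_sigma]
  refine Finset.card_le_card_of_surjOn
    (fun p : (_ : Fin w) × Fin (n / w + 1) => residueVar hwn p.1 p.2) fun j hj => ?_
  obtain ⟨r, q, rfl⟩ := exists_residueVar_eq hw hwn j
  refine ⟨⟨r, q⟩, ?_, rfl⟩
  simpa using hj

/-- The count is the product of M + a_r over the classes, where a_r is the number of free indices.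
Bernoulli's inequality 2^t ≤ 1 + t for t = a_r / M in [0, 1] turns the product into a power of 2
with exponent the sum of the a_r / M. -/
theorem le_card_compatibleCodes {n w : ℕ} (hw : 0 < w) (hwn : w ≤ n) (Q : Finset (Fin n))
    (x : Fin n → Bool) :
    ((n / w + 1 : ℕ) : ℝ) ^ w * 2 ^ ((Qᶜ.card : ℝ) / (n / w + 1 : ℕ))
      ≤ (compatibleCodes (w := w) hwn Q x).card := by
  set M := n / w + 1 with hM
  have hMpos : (0 : ℝ) < (M : ℝ) := by rw [hM]; positivity
  set a : Fin w → ℕ := fun r => (Finset.univ.filter fun q => residueVar hwn r q ∉ Q).card with ha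
  have hcard : ((compatibleCodes (w := w) hwn Q x).card : ℝ) = ∏ r, ((M : ℝ) + a r) := by
    unfold compatibleCodes
    rw [Fintype.card_piFinset]
    simp only [card_compatible_literals]
    push_cast
    simp [hM, ha]
  have hfac : ∀ r, (M : ℝ) * 2 ^ ((a r : ℝ) / M) ≤ M + a r := by
    intro r
    have haM : (a r : ℝ) ≤ M := by
      have : a r ≤ M := (Finset.card_le_univ _).trans (by simp [hM])
      exact_mod_cast this
    have h := rpow_one_add_le_one_add_mul_self (s := 1) (p := (a r : ℝ) / M) (by norm_num)
      (by positivity) ((div_le_one hMpos).2 haM)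
    norm_num at h
    calc (M : ℝ) * 2 ^ ((a r : ℝ) / M) ≤ M * (1 + a r / M) := by gcongr
      _ = M + a r := by field_simp
  calc (M : ℝ) ^ w * 2 ^ ((Qᶜ.card : ℝ) / M)
      ≤ (M : ℝ) ^ w * 2 ^ (∑ r, (a r : ℝ) / M) := by
        gcongr
        · norm_num
        · rw [← Finset.sum_div]
          gcongr
          exact_mod_cast card_compl_le_sum hw hwn Q
    _ = ∏ r, ((M : ℝ) * 2 ^ ((a r : ℝ) / M)) := by
        rw [Finset.prod_mul_distrib, Real.rpow_sum_of_pos (by norm_num)]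
        simp
    _ ≤ ∏ r, ((M : ℝ) + a r) := Finset.prod_le_prod (fun r _ => by positivity) fun r _ => hfac r
    _ = _ := hcard.symm

/-- A union bound: some `s` terms of width `w` meet every subcube with `k` free variables. -/
theorem exists_hitting_terms {n w s k : ℕ} (hw : 0 < w) (hwn : w ≤ n)
    (hs : (2 : ℝ) ^ w / w ≤ s) (hk : (2 * n * w : ℝ) ≤ 2 ^ ((k : ℝ) / (n / w + 1 : ℕ))) :
    ∃ (A : Fin s → Finset (Fin n)) (σ : Fin s → Fin n → Bool), (∀ t, (A t).card = w) ∧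
      ∀ (Q : Finset (Fin n)) (x : Fin n → Bool), k ≤ Qᶜ.card →
        ∃ t, ∀ i ∈ A t, i ∈ Q → x i = σ t i := by
  classical
  set M := n / w + 1 with hM
  have hMpos : (0 : ℝ) < (M : ℝ) := by rw [hM]; positivity
  have hwpos : (0 : ℝ) < (w : ℝ) := by exact_mod_cast hw
  have hnpos : (0 : ℝ) < (n : ℝ) := by exact_mod_cast hw.trans_le hwn
  suffices ∃ c : Fin s → TermCode n w, ∀ (Q : Finset (Fin n)) (x : Fin n → Bool), k ≤ Qᶜ.card →
      ∃ t, c t ∈ compatibleCodes hwn Q x by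
    obtain ⟨c, hc⟩ := this
    refine ⟨fun t => (c t).vars hwn, fun t => (c t).signs hw, fun t => (c t).card_vars hwn,
      fun Q x h => ?_⟩
    obtain ⟨t, ht⟩ := hc Q x h
    exact ⟨t, agree_of_mem_compatibleCodes hw hwn ht⟩
  -- If every choice of `s` codes misses some subcube, the choices are covered by the sets of those
  -- missing a given (Q, x); these are too few.
  by_contra! hbad
  set P := (Finset.univ : Finset (Finset (Fin n) × (Fin n → Bool))).filter
    fun p => k ≤ p.1ᶜ.card with hP
  have hcover : (Finset.univ : Finset (Fin s → TermCode n w))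
      ⊆ P.biUnion fun p => Fintype.piFinset fun _ => (compatibleCodes hwn p.1 p.2)ᶜ := by
    intro c _
    obtain ⟨Q, x, hQ, h⟩ := hbad c
    refine Finset.mem_biUnion.2 ⟨(Q, x), by simp [hP, hQ], ?_⟩
    simpa [Fintype.mem_piFinset] using h
  have hN : (Fintype.card (TermCode n w) : ℝ) = (M : ℝ) ^ w * 2 ^ w := by
    simp [TermCode, hM, mul_pow]
  -- One code hits with probability at least 2nw / 2^w, so s ≥ 2^w / w codes all miss with
  -- probability at most e^(-2n).
  have hone : ∀ p ∈ P, ((Fintype.piFinset fun _ : Fin s =>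
      (compatibleCodes (w := w) hwn p.1 p.2)ᶜ).card : ℝ)
      ≤ ((M : ℝ) ^ w * 2 ^ w) ^ s * Real.exp (-(2 * n)) := by
    intro p hp
    have hp' : k ≤ p.1ᶜ.card := (Finset.mem_filter.1 hp).2
    have h1 := le_card_compatibleCodes hw hwn p.1 p.2
    rw [← hM] at h1
    have h2 : (2 * n * w : ℝ) ≤ 2 ^ ((p.1ᶜ.card : ℝ) / M) := by
      refine hk.trans ?_
      gcongr
      norm_num
    have h3 : (((compatibleCodes (w := w) hwn p.1 p.2)ᶜ.card : ℕ) : ℝ)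
        ≤ (M : ℝ) ^ w * 2 ^ w * Real.exp (-(2 * n * w / 2 ^ w)) := by
      have h4 : (((compatibleCodes (w := w) hwn p.1 p.2)ᶜ.card : ℕ) : ℝ)
          = (M : ℝ) ^ w * 2 ^ w - (compatibleCodes (w := w) hwn p.1 p.2).card := by
        rw [← hN, ← Finset.card_add_card_compl (compatibleCodes (w := w) hwn p.1 p.2)]
        push_cast
        ring
      have h5 : (M : ℝ) ^ w * (2 * n * w) ≤ (compatibleCodes (w := w) hwn p.1 p.2).card :=
        le_trans (by gcongr) h1
      have h6 := Real.add_one_le_exp (-(2 * n * w / 2 ^ w : ℝ))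
      calc _ ≤ (M : ℝ) ^ w * 2 ^ w - (M : ℝ) ^ w * (2 * n * w) := by rw [h4]; linarith
        _ = (M : ℝ) ^ w * 2 ^ w * (-(2 * n * w / 2 ^ w : ℝ) + 1) := by field_simp; ring
        _ ≤ _ := by gcongr
    rw [Fintype.card_piFinset]
    simp only [Finset.prod_const, Finset.card_univ, Fintype.card_fin, Nat.cast_pow]
    calc _ ≤ ((M : ℝ) ^ w * 2 ^ w * Real.exp (-(2 * n * w / 2 ^ w))) ^ s := by gcongr
      _ = ((M : ℝ) ^ w * 2 ^ w) ^ s * Real.exp (s * -(2 * n * w / 2 ^ w)) := by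
          rw [mul_pow, Real.exp_nat_mul]
      _ ≤ _ := by
          gcongr
          have : (2 * n : ℝ) = 2 ^ w / w * (2 * n * w / 2 ^ w) := by field_simp
          have h7 : 2 ^ w / w * (2 * n * w / 2 ^ w : ℝ) ≤ s * (2 * n * w / 2 ^ w) := by gcongr
          linarith
  have hPcard : (P.card : ℝ) ≤ 4 ^ n := by
    have : P.card ≤ 4 ^ n := by
      refine (Finset.card_le_univ P).trans (le_of_eq ?_)
      simp [← mul_pow]
    exact_mod_cast this
  have htotal : ((M : ℝ) ^ w * 2 ^ w) ^ s
      ≤ 4 ^ n * (((M : ℝ) ^ w * 2 ^ w) ^ s * Real.exp (-(2 * n))) := by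
    have h1 : ((Finset.univ : Finset (Fin s → TermCode n w)).card : ℝ)
        = ((M : ℝ) ^ w * 2 ^ w) ^ s := by
      rw [Finset.card_univ, Fintype.card_pi_const, Nat.cast_pow, hN]
    rw [← h1]
    calc _ ≤ ((∑ p ∈ P, (Fintype.piFinset fun _ : Fin s =>
          (compatibleCodes (w := w) hwn p.1 p.2)ᶜ).card : ℕ) : ℝ) :=
          Nat.cast_le.2 ((Finset.card_le_card hcover).trans Finset.card_biUnion_le)
      _ ≤ ∑ _p ∈ P, ((M : ℝ) ^ w * 2 ^ w) ^ s * Real.exp (-(2 * n)) := by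
          push_cast
          exact Finset.sum_le_sum hone
      _ ≤ _ := by
          rw [Finset.sum_const, nsmul_eq_mul, h1]
          gcongr
  have hlt : (4 : ℝ) ^ n * Real.exp (-(2 * n)) < 1 := by
    have h1 : (4 : ℝ) < Real.exp 2 := by
      have := Real.exp_one_gt_d9
      rw [show (2 : ℝ) = 1 + 1 by norm_num, Real.exp_add]
      nlinarith
    have h2 : (4 : ℝ) ^ n < Real.exp 2 ^ n :=
      pow_lt_pow_left₀ h1 (by norm_num) (by omega)
    rw [Real.exp_neg, ← div_eq_mul_inv, div_lt_one (Real.exp_pos _), mul_comm (2 : ℝ),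
      Real.exp_nat_mul]
    exact h2
  have hpos : (0 : ℝ) < ((M : ℝ) ^ w * 2 ^ w) ^ s := by positivity
  nlinarith

/-! ### From the gap to θ; the cases n = 1 and n = 2 -/

/-- The equation forces θ = n log n / (n − D), so the bounds on the gap n − D are bounds on θ / w.
-/
theorem exists_theta {n w D : ℝ} (hn : 2 ≤ n) (hw : 0 < w)
    (h₁ : n * Real.logb 2 n / (60 * w) ≤ n - D) (h₂ : n - D ≤ 9 * (n * Real.logb 2 n) / w) :
    ∃ θ : ℝ, 1 / 9 * w ≤ θ ∧ θ ≤ 60 * w ∧ D = n * (1 - Real.logb 2 n / θ) := by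
  have hL : 0 < Real.logb 2 n := Real.logb_pos (by norm_num) (by linarith)
  have hnL : 0 < n * Real.logb 2 n := by positivity
  have hδ : 0 < n - D := lt_of_lt_of_le (by positivity) h₁
  refine ⟨n * Real.logb 2 n / (n - D), ?_, ?_, ?_⟩
  · rw [le_div_iff₀ hδ]
    rw [le_div_iff₀ hw] at h₂
    linarith
  · rw [div_le_iff₀ hδ]
    rw [div_le_iff₀ (by positivity)] at h₁
    linarith
  · field_simp
    ring

theorem one_le_dAve_of_ne {n : ℕ} {f : (Fin n → Bool) → Bool} {x y : Fin n → Bool}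
    (h : f x ≠ f y) : 1 ≤ dAve f := by
  obtain ⟨T, hT, hD⟩ := exists_averageCost_eq_dAve f
  rw [← hD, DecisionTree.averageCost, le_div_iff₀ (by positivity)]
  cases T with
  | leaf b => exact absurd ((hT x).symm.trans (hT y)) h
  | node i T₀ T₁ =>
    have : ∀ z ∈ (Finset.univ : Finset (Fin n → Bool)),
        (1 : ℝ) ≤ ((DecisionTree.node i T₀ T₁).cost z : ℝ) := fun z _ => by
      exact_mod_cast Nat.le_add_left 1 _
    have := Finset.sum_le_sum this
    simpa using this

theorem dAve_le_card {n : ℕ} (f : (Fin n → Bool) → Bool) : dAve f ≤ n := by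
  obtain ⟨T, hT, hcost⟩ := DecisionTree.exists_two_stage f Finset.univ (fun _ => ∅)
    (fun _ _ _ => rfl) fun x y h _ => congrArg f (funext fun i => h i (Finset.mem_univ i))
  refine (dAve_le_averageCost hT).trans ?_
  rw [DecisionTree.averageCost, div_le_iff₀ (by positivity)]
  have : ∀ x ∈ (Finset.univ : Finset (Fin n → Bool)), (T.cost x : ℝ) ≤ n := fun x _ => by
    have := hcost x
    simp only [Finset.card_univ, Fintype.card_fin, Finset.card_empty, add_zero] at this
    exact_mod_cast this
  refine (Finset.sum_le_sum this).trans (le_of_eq ?_)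
  simp [mul_comm]

/-- The case n = w = 1: log n vanishes, so the value must be exactly n. -/
theorem dAve_one_variable {s : ℕ} (hs : 0 < s) :
    dAve (unionOfSubcubes (fun _ : Fin s => (Finset.univ : Finset (Fin 1))) fun _ _ => true)
      = 1 := by
  refine le_antisymm ((dAve_le_card _).trans (by simp))
    (one_le_dAve_of_ne (x := fun _ => true) (y := fun _ => false) ?_)
  have : Nonempty (Fin s) := ⟨⟨0, hs⟩⟩
  simp [unionOfSubcubes]

/-- The case n = w = 2, with both terms equal to the AND of the two variables: the second query is
saved on half of the inputs. -/
theorem dAve_and_two_le :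
    dAve (unionOfSubcubes (fun _ : Fin 2 => (Finset.univ : Finset (Fin 2))) fun _ _ => true)
      ≤ 3 / 2 := by
  refine (dAve_le_averageCost
    (T := .node 0 (.leaf false) (.node 1 (.leaf false) (.leaf true))) fun x => ?_).trans ?_
  · cases h0 : x 0 <;> cases h1 : x 1 <;>
      simp [DecisionTree.eval, unionOfSubcubes, Fin.forall_fin_two, h0, h1]
  · have h : ∑ x : Fin 2 → Bool, (DecisionTree.node (0 : Fin 2) (.leaf false)
        (.node 1 (.leaf false) (.leaf true))).cost x = 6 := by decide
    rw [DecisionTree.averageCost, div_le_iff₀ (by positivity), ← Nat.cast_sum, h]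
    norm_num

/-- Integer form of the hypothesis on w, used to separate the small cases. -/
theorem nat_le_of_two_mul_logb_le {n w : ℕ} (h : 2 * Real.logb 2 (n : ℝ) ≤ w) (hn : 0 < n) :
    n ^ 2 ≤ 2 ^ w := by
  have hn' : (0 : ℝ) < n := by exact_mod_cast hn
  have h1 : Real.logb 2 ((n : ℝ) ^ 2) ≤ w := by
    rw [Real.logb_pow]
    exact_mod_cast h
  rw [Real.logb_le_iff_le_rpow (by norm_num) (by positivity), Real.rpow_natCast] at h1
  exact_mod_cast h1

theorem two_mul_le_two_pow_pred {w : ℕ} (hw : 4 ≤ w) : 2 * w ≤ 2 ^ (w - 1) := by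
  induction w, hw using Nat.le_induction with
  | base => norm_num
  | succ w hw ih =>
    obtain ⟨v, rfl⟩ : ∃ v, w = v + 1 := ⟨w - 1, by omega⟩
    simp only [Nat.add_sub_cancel] at ih ⊢
    rw [pow_succ]
    omega

/-! ### Choice of parameters and conclusion -/

/-- The lower bound for a DNF whose terms hit every large subcube. -/
theorem exists_hitting_terms_dAve {n w s : ℕ} (hw : 1 ≤ w) (hn : 2 ≤ n) (hwn : w ≤ n)
    (hs : (2 : ℝ) ^ w / w ≤ s) (hs' : (s : ℝ) ≤ 2 ^ w / w + 1) :
    ∃ (A : Fin s → Finset (Fin n)) (σ : Fin s → Fin n → Bool), (∀ t, (A t).card = w) ∧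
      n - dAve (unionOfSubcubes A σ) ≤ 9 * (n * Real.logb 2 n) / w := by
  set M := n / w + 1 with hM
  have hMpos : (0 : ℝ) < (M : ℝ) := by rw [hM]; positivity
  have hw0 : (0 : ℝ) < (w : ℝ) := by exact_mod_cast hw
  have hn2 : (2 : ℝ) ≤ (n : ℝ) := by exact_mod_cast hn
  have hwn' : (w : ℝ) ≤ (n : ℝ) := by exact_mod_cast hwn
  have hL : 1 ≤ Real.logb 2 n := by
    rw [Real.le_logb_iff_rpow_le (by norm_num) (by linarith)]
    simpa using hn2
  have hMle : (M : ℝ) ≤ 2 * n / w := by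
    have h1 : ((n / w : ℕ) : ℝ) ≤ n / w := Nat.cast_div_le
    have h2 : (1 : ℝ) ≤ n / w := by rwa [le_div_iff₀ hw0, one_mul]
    rw [hM, mul_div_assoc]
    push_cast
    linarith
  have hlog : Real.logb 2 (2 * n * w) ≤ 3 * Real.logb 2 n := by
    have h1 : (2 * n * w : ℝ) ≤ n ^ 3 := by
      calc (2 * n * w : ℝ) ≤ n * n * n := by gcongr
        _ = n ^ 3 := by ring
    calc Real.logb 2 (2 * n * w) ≤ Real.logb 2 ((n : ℝ) ^ 3) :=
          Real.logb_le_logb_of_le (by norm_num) (by positivity) h1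
      _ = 3 * Real.logb 2 n := by rw [Real.logb_pow]; norm_num
  have hlog0 : 0 ≤ Real.logb 2 (2 * n * w) := by
    refine Real.logb_nonneg (by norm_num) ?_
    have : (1 : ℝ) ≤ w := by exact_mod_cast hw
    nlinarith
  -- The least k for which the union bound applies.
  set k := ⌈(M : ℝ) * Real.logb 2 (2 * n * w)⌉₊ with hk
  have hk1 : (M : ℝ) * Real.logb 2 (2 * n * w) ≤ k := Nat.le_ceil _
  have hk2 : (k : ℝ) < (M : ℝ) * Real.logb 2 (2 * n * w) + 1 := Nat.ceil_lt_add_one (by positivity)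
  obtain ⟨A, σ, hA, hhit⟩ := exists_hitting_terms (s := s) (k := k) hw hwn hs (by
    rw [← Real.logb_le_iff_le_rpow (by norm_num) (by positivity), ← hM, le_div_iff₀ hMpos]
    linarith)
  refine ⟨A, σ, hA, ?_⟩
  have hlow := le_dAve_unionOfSubcubes A σ hA hhit
  have h1 : (s : ℝ) / 2 ^ w ≤ 2 / w := by
    have h2 : (w : ℝ) ≤ 2 ^ w := by exact_mod_cast Nat.lt_two_pow_self.le
    have h3 : (1 : ℝ) ≤ 2 ^ w / w := by rwa [le_div_iff₀ hw0, one_mul]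
    rw [div_le_iff₀ (by positivity)]
    calc (s : ℝ) ≤ 2 ^ w / w + 2 ^ w / w := by linarith
      _ = _ := by ring
  have h4 : (n : ℝ) * (s / 2 ^ w) ≤ n * (2 / w) := by gcongr
  have h5 : (M : ℝ) * Real.logb 2 (2 * n * w) ≤ 2 * n / w * (3 * Real.logb 2 n) := by gcongr
  have h6 : (1 : ℝ) ≤ n * Real.logb 2 n / w := by
    rw [le_div_iff₀ hw0]
    nlinarith
  have h7 : (n : ℝ) * (2 / w) ≤ 2 * (n * Real.logb 2 n / w) := by
    have : (n : ℝ) * 1 / w ≤ n * Real.logb 2 n / w := by gcongr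
    calc (n : ℝ) * (2 / w) = 2 * (n * 1 / w) := by ring
      _ ≤ _ := by linarith
  -- In units of n log n / w, the constant 9 is 6 from M log(2nw), 1 from rounding k up and 2 from
  -- the inputs that satisfy a term.
  have h8 : 2 * n / w * (3 * Real.logb 2 n) = 6 * (n * Real.logb 2 n / w) := by ring
  rw [mul_div_assoc]
  linarith

/-- The upper bound for a DNF of width `w` and size about `2 ^ w / w`. -/
theorem le_sub_dAve {n w s : ℕ} (hw : 4 ≤ w) (hn : 4 ≤ n)
    (hlog : 2 * Real.logb 2 (n : ℝ) ≤ w) (hs : (s : ℝ) ≤ 2 ^ w / w + 1)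
    (A : Fin s → Finset (Fin n)) (σ : Fin s → Fin n → Bool) (hA : ∀ t, (A t).card = w) :
    n * Real.logb 2 n / (60 * w) ≤ n - dAve (unionOfSubcubes A σ) := by
  have hw0 : (0 : ℝ) < (w : ℝ) := by exact_mod_cast (by omega : 0 < w)
  have hn4 : (4 : ℝ) ≤ (n : ℝ) := by exact_mod_cast hn
  have hn0 : (0 : ℝ) < (n : ℝ) := by linarith
  have hln : Real.log n = Real.logb 2 n * Real.log 2 := by
    rw [Real.logb, div_mul_cancel₀]
    exact (Real.log_pos (by norm_num)).ne'
  have hL : 0 < Real.logb 2 n := Real.logb_pos (by norm_num) (by linarith)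
  have hl2 := Real.log_two_gt_d9
  have hl2' := Real.log_two_lt_d9
  set α : ℝ := Real.log n / (4 * w) with hα
  have hlnpos : 0 < Real.log n := Real.log_pos (by linarith)
  have hα0 : 0 < α := by positivity
  have hα1 : α ≤ 1 := by
    rw [hα, div_le_one (by positivity), hln]
    nlinarith
  have hup := dAve_unionOfSubcubes_le A σ hA hα0.le hα1
  -- Here y = n^(1/4), which bounds (1 + α)^(w − 1) because αw = ln n / 4.
  set y : ℝ := Real.exp (Real.log n / 4) with hy
  have hy4 : y ^ 4 = n := by
    rw [hy, ← Real.exp_nat_mul]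
    push_cast
    rw [mul_div_cancel₀ _ (by norm_num : (4 : ℝ) ≠ 0), Real.exp_log hn0]
  have hy0 : 0 < y := Real.exp_pos _
  have hy2 : 2 ≤ y ^ 2 := by nlinarith [sq_nonneg (y ^ 2)]
  have hy1 : 1.4 ≤ y := by nlinarith
  have hpow : (1 + α) ^ (w - 1) ≤ y := by
    calc (1 + α) ^ (w - 1) ≤ (1 + α) ^ w := by
          gcongr
          · linarith
          · omega
      _ ≤ Real.exp α ^ w := by
          gcongr
          linarith [Real.add_one_le_exp α]
      _ = y := by
          rw [← Real.exp_nat_mul, hy, hα]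
          congr 1
          field_simp
  have hcoef : (s : ℝ) * w / 2 ^ (w - 1) ≤ 5 / 2 := by
    have h2 : (2 * w : ℝ) ≤ 2 ^ (w - 1) := by exact_mod_cast two_mul_le_two_pow_pred hw
    have h3 : (2 : ℝ) ^ w = 2 * 2 ^ (w - 1) := by
      rw [← pow_succ', Nat.sub_add_cancel (by omega)]
    rw [div_le_iff₀ (by positivity)]
    calc (s : ℝ) * w ≤ (2 ^ w / w + 1) * w := by gcongr
      _ = 2 ^ w + w := by field_simp
      _ ≤ _ := by rw [h3]; linarith
  have hterm : (s : ℝ) * (w * (α * ((1 + α) / 2) ^ (w - 1))) ≤ α * (5 / 2 * y) := by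
    calc (s : ℝ) * (w * (α * ((1 + α) / 2) ^ (w - 1)))
        = α * (s * w / 2 ^ (w - 1) * (1 + α) ^ (w - 1)) := by rw [div_pow]; ring
      _ ≤ _ := by gcongr
  -- As y^4 = n ≥ 4, y^3 ≥ 2√2 > 25/9; the code uses 1.4 · 2 = 2.8. This is where n ≥ 4 is needed.
  have hyn : 5 / 2 * y ≤ 9 / 10 * n := by
    rw [← hy4]
    have h3 : 2.8 ≤ y ^ 3 := by nlinarith
    nlinarith
  -- A tenth of the saving αn remains, namely n ln n / (40w); since ln 2 ≥ 2/3, the constant 60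
  -- results.
  have hfin : n * Real.logb 2 n / (60 * w) ≤ α * (n / 10) := by
    have h1 : α * (n / 10) = n * Real.logb 2 n / (60 * w) * (3 / 2 * Real.log 2) := by
      rw [hα, hln]
      field_simp
      norm_num
    rw [h1]
    refine le_mul_of_one_le_right (by positivity) (by linarith)
  nlinarith

theorem theorem3 :
    ∃ c C : ℝ, 0 < c ∧ c ≤ C ∧
      ∀ n w : ℕ, 1 ≤ w → 2 * Real.logb 2 (n : ℝ) ≤ (w : ℝ) → w ≤ n →
        ∃ f : (Fin n → Bool) → Bool,
          (∃ φ : DNF n, φ.Computes f ∧ φ.width = w ∧ φ.size = ⌈(2 : ℝ) ^ w / (w : ℝ)⌉₊) ∧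
          ∃ θ : ℝ, c * (w : ℝ) ≤ θ ∧ θ ≤ C * (w : ℝ) ∧
            dAve f = (n : ℝ) * (1 - Real.logb 2 (n : ℝ) / θ) := by
  refine ⟨1 / 9, 60, by norm_num, by norm_num, fun n w hw hlog hwn => ?_⟩
  have hw0 : (0 : ℝ) < (w : ℝ) := by exact_mod_cast hw
  have hsq := nat_le_of_two_mul_logb_le hlog (by omega)
  have hs0 : 0 < ⌈(2 : ℝ) ^ w / (w : ℝ)⌉₊ := Nat.ceil_pos.2 (by positivity)
  have hs : (2 : ℝ) ^ w / w ≤ (⌈(2 : ℝ) ^ w / (w : ℝ)⌉₊ : ℝ) := Nat.le_ceil _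
  have hs' : (⌈(2 : ℝ) ^ w / (w : ℝ)⌉₊ : ℝ) ≤ 2 ^ w / w + 1 :=
    (Nat.ceil_lt_add_one (by positivity)).le
  rcases Nat.lt_or_ge n 4 with hn | hn
  -- From n² ≤ 2^w and w ≤ n; n = 3 is impossible because 9 > 2^3.
  · obtain ⟨rfl, rfl⟩ | ⟨rfl, rfl⟩ : (n = 1 ∧ w = 1) ∨ (n = 2 ∧ w = 2) := by
      have hw4 : w < 4 := by omega
      interval_cases n <;> interval_cases w <;> simp_all
    · refine ⟨unionOfSubcubes (fun _ : Fin ⌈(2 : ℝ) ^ 1 / ((1 : ℕ) : ℝ)⌉₊ => Finset.univ)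
        fun _ _ => true, exists_dnf_unionOfSubcubes hs0 _ _ (by simp), 1, by norm_num,
        by norm_num, ?_⟩
      rw [dAve_one_variable hs0]
      simp
    · have h2 : ⌈(2 : ℝ) ^ 2 / ((2 : ℕ) : ℝ)⌉₊ = 2 := by norm_num
      rw [h2]
      refine ⟨_, exists_dnf_unionOfSubcubes (by norm_num)
        (fun _ : Fin 2 => (Finset.univ : Finset (Fin 2))) (fun _ _ => true) (by simp), ?_⟩
      have h3 := dAve_and_two_le
      have h4 := dAve_nonneg
        (unionOfSubcubes (fun _ : Fin 2 => (Finset.univ : Finset (Fin 2))) fun _ _ => true)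
      refine exists_theta (by norm_num) hw0 ?_ ?_ <;> norm_num <;> linarith
  · have hw4 : 4 ≤ w := by
      by_contra! h
      have : 2 ^ w ≤ 2 ^ 3 := Nat.pow_le_pow_right (by norm_num) (by omega)
      nlinarith
    obtain ⟨A, σ, hA, hlow⟩ := exists_hitting_terms_dAve hw (by omega) hwn hs hs'
    exact ⟨_, exists_dnf_unionOfSubcubes hs0 A σ hA, exists_theta
      (by exact_mod_cast (by omega : 2 ≤ n)) hw0 (le_sub_dAve hw4 hn hlog hs' A σ hA) hlow⟩
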